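/- For integers $n\ge 1$ and $1\le a_1,a_2,a_3\le n/2$ let $C_n(a_1,a_2,a_3)$ be the circulant graph with vertex set $\mathbb{Z}/n\mathbb{Z}$ in which each vertex $v$ is adjacent to $v\pm a_1,\ v\pm a_2,\ v\pm a_3 \pmod n$. The genus of a finite graph is the minimum genus of a closed orientable surface on which the graph embeds without crossings. **Proposition 4.3.** Let $G=C_n(a_1,a_2,a_3)$ be connected (equivalently $\gcd(a_1,a_2,a_3,n)=1$), where $n=2^r l$, $a_1=2^{r_1}l_1$, $a_2=2^{r_2}l_2$, the integers $l,l_1,l_2,a_3$ are odd, and $0<r_2<r_1<r$. Suppose that $n\ne 2a_1$ and that $a_1\not\equiv\pm 2a_2$ and $a_2\not\equiv\pm 2a_3 \pmod n$. Then the genus of $G$ is exactly $\dfrac{n+4}{4}$. -/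

import Mathlib

namespace SimpleGraph

variable {V : Type*}

/-- A rotation system on `G`: at every vertex, a cyclic order of all the edge-ends (darts) leaving
that vertex.  `next d` is the dart that follows `d` (say, counterclockwise) around `d.fst`.

Rotation systems are the standard combinatorial form of the embeddings, without crossings and with
open discs as faces, of the components of `G` in closed oriented surfaces: thicken the vertices
and the edges of `G` to a ribbon surface as prescribed by the rotation, and glue one disc to each
boundary circle. -/
structure RotationSystem (G : SimpleGraph V) where
  /-- the successor of a dart in the rotation at its initial vertex -/
  next : Equiv.Perm G.Dart
  /-- the rotation keeps the initial vertex -/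
  fst_next : ∀ d : G.Dart, (next d).fst = d.fst
  /-- the darts at one vertex form one cycle -/
  sameCycle : ∀ d e : G.Dart, d.fst = e.fst → next.SameCycle d e

namespace RotationSystem

variable {G : SimpleGraph V} (R : RotationSystem G)

/-- Face tracing: walk along a dart, and continue with the dart that follows its reverse in the
rotation at the vertex where one arrives.  The orbits are the boundary walks of the faces. -/
def facePerm : Equiv.Perm G.Dart :=
  (Function.Involutive.toPerm Dart.symm Dart.symm_involutive).trans R.next

/-- The number of faces: the number of orbits of face tracing, plus one face (the rest of a sphere)
for each isolated vertex, which has no darts. -/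
noncomputable def numFaces : ℕ :=
  Nat.card (Quotient (Equiv.Perm.SameCycle.setoid R.facePerm)) +
    Nat.card {v : V // ∀ w, ¬ G.Adj v w}

/-- The surface of the embedding has genus `g`, as read off from Euler's relation
`v - e + f = 2 - 2 g`, the right-hand side being `2 c - 2 g` for a graph with `c` components (the
components lie on `c` surfaces, whose genera sum to `g`, the genus of their connected sum). -/
def HasGenus (g : ℕ) : Prop :=
  (Nat.card V : ℤ) - (Nat.card G.edgeSet : ℤ) + (R.numFaces : ℤ) =
    2 * (Nat.card G.ConnectedComponent : ℤ) - 2 * (g : ℤ)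

end RotationSystem

/-- `g` is the genus of the finite graph `G`: the least genus of a closed orientable surface on
which `G` embeds without crossings.  (On a surface of least genus all the faces of a connected graph
are open discs, so it is the least genus over all the rotation systems.) -/
def IsGenus [Finite V] (G : SimpleGraph V) (g : ℕ) : Prop :=
  IsLeast {h : ℕ | ∃ R : RotationSystem G, R.HasGenus h} g

end SimpleGraph

/-- The circulant graph `C_n(a₁, a₂, a₃)`: its vertices are the residues modulo `n`, and `v` is
adjacent to `v ± a₁`, `v ± a₂`, `v ± a₃`. -/
def circulant3 (n a₁ a₂ a₃ : ℕ) : SimpleGraph (ZMod n) :=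
  SimpleGraph.circulantGraph {(a₁ : ZMod n), (a₂ : ZMod n), (a₃ : ZMod n)}

open SimpleGraph

/-! ### Counting the orbits of a permutation -/

namespace Equiv.Perm

variable {α : Type*} [Finite α]

/-! Write `a`, `b`, `c` for the three jumps. By 2-adic valuations and the excluded congruences, no
nontrivial relation `x a + y b + z c = 0` modulo `n` has `|x| + |y| + |z| ≤ 3`
(`not_dvd_of_natAbs_le_three`). So the graph is 6-regular and triangle-free, every face has length
at least 4, and Euler's relation gives genus at least `n / 4 + 1`. Equality holds exactly when all
faces are quadrilaterals.

Such an embedding comes from the cosets of `⟨a, b⟩`: each is a square lattice on a torus, and `c`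
joins consecutive ones. Select lattice squares so that every vertex lies in exactly one. Remove each
selected square and its translate by `c`, and join the two holes by a tube, which the four `c`-edges
cut into quadrilaterals. Since `a`, `b` are even and `c` is odd, orientations can alternate between
layers. The tubes leaving and entering a layer must use different squares (`corner_add_ne`); binary
digits of residues, measured in units of `c`, supply such a selection. -/

theorem card_le_mul_card_quotient_sameCycle (f : Perm α) {k : ℕ} (hk : 0 < k) (hf : f ^ k = 1) :
    Nat.card α ≤ k * Nat.card (Quotient (SameCycle.setoid f)) := by
  have hs : Function.Surjective
      (fun x : Quotient (SameCycle.setoid f) × Fin k => (f ^ (x.2 : ℕ)) x.1.out) := by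
    intro x
    obtain ⟨i, hi⟩ : f.SameCycle (Quotient.mk (SameCycle.setoid f) x).out x :=
      Quotient.mk_out (s := SameCycle.setoid f) x
    have hk' : (0 : ℤ) < k := by exact_mod_cast hk
    have h0 := Int.emod_nonneg i hk'.ne'
    have h1 := Int.emod_lt_of_pos i hk'
    refine ⟨(Quotient.mk _ x, ⟨(i % k).toNat, by omega⟩), ?_⟩
    have h2 : f ^ (i % (k : ℤ)).toNat = f ^ i := by
      rw [← zpow_natCast, Int.toNat_of_nonneg h0]
      conv_rhs => rw [← Int.emod_add_mul_ediv i k, zpow_add, zpow_mul, zpow_natCast, hf, one_zpow,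
        mul_one]
    simp only [h2, hi]
  have := Nat.card_le_card_of_surjective _ hs
  rwa [Nat.card_prod, Nat.card_fin, mul_comm] at this

theorem mul_card_quotient_sameCycle_le (f : Perm α) {k : ℕ}
    (hf : ∀ x i, 0 < i → i < k → (f ^ i) x ≠ x) :
    k * Nat.card (Quotient (SameCycle.setoid f)) ≤ Nat.card α := by
  have hlt : ∀ x (i j : ℕ), i < j → j < k → (f ^ i) x ≠ (f ^ j) x := by
    intro x i j hij hj h
    refine hf x (j - i) (by omega) (by omega) ((f ^ i).injective ?_)
    rw [← mul_apply, ← pow_add, h]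
    congr 2
    omega
  have hi : Function.Injective
      (fun x : Quotient (SameCycle.setoid f) × Fin k => (f ^ (x.2 : ℕ)) x.1.out) := by
    rintro ⟨q, i⟩ ⟨q', j⟩ h
    simp only at h
    have hq : q = q' := by
      rw [← Quotient.out_equiv_out]
      change f.SameCycle _ _
      rw [← sameCycle_pow_left (n := i), h, sameCycle_pow_left]
    subst hq
    rcases lt_trichotomy i j with hij | hij | hij
    · exact (hlt _ _ _ hij j.2 h).elim
    · rw [hij]
    · exact (hlt _ _ _ hij i.2 h.symm).elim
  have := Nat.card_le_card_of_injective _ hi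
  rwa [Nat.card_prod, Nat.card_fin, mul_comm] at this

end Equiv.Perm

/-! ### Faces of rotation systems of triangle-free graphs -/

namespace SimpleGraph.RotationSystem

variable {V : Type*} {G : SimpleGraph V} (R : RotationSystem G)

theorem facePerm_apply (d : G.Dart) : R.facePerm d = R.next d.symm := rfl

theorem fst_facePerm (d : G.Dart) : (R.facePerm d).fst = d.snd := R.fst_next _

theorem four_mul_card_face_le [Finite V] (h3 : ∀ u v w, G.Adj u v → G.Adj v w → ¬ G.Adj w u)
    (h2 : ∀ u v, G.Adj u v → ∃ w, G.Adj u w ∧ w ≠ v) :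
    4 * Nat.card (Quotient (Equiv.Perm.SameCycle.setoid R.facePerm)) ≤ Nat.card G.Dart := by
  have : Finite G.Dart :=
    Finite.of_injective (fun d : G.Dart => d.toProd) fun d e h => Dart.ext _ _ h
  refine Equiv.Perm.mul_card_quotient_sameCycle_le _ fun x i h0 hi => ?_
  have e1 := R.fst_facePerm x
  have e2 := R.fst_facePerm (R.facePerm x)
  have e3 := R.fst_facePerm (R.facePerm (R.facePerm x))
  interval_cases i
  · rw [pow_one]
    intro h
    rw [h] at e1
    exact G.ne_of_adj x.adj e1
  · rw [pow_two, Equiv.Perm.mul_apply]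
    intro h
    rw [h] at e2
    -- A face of length 2 retraces its edge, so the rotation fixes a dart and its initial vertex has
    -- degree one.
    have hx : R.next x.symm = x.symm := Dart.ext _ _ (Prod.ext e1 e2.symm)
    obtain ⟨w, hw, hne⟩ := h2 x.snd x.fst x.adj.symm
    have hc := R.sameCycle x.symm ⟨(x.snd, w), hw⟩ rfl
    have := (Equiv.Perm.SameCycle.eq_of_left hc hx)
    exact hne (congrArg (fun d : G.Dart => d.snd) this).symm
  · rw [pow_succ, pow_two, Equiv.Perm.mul_apply, Equiv.Perm.mul_apply]
    intro h
    rw [h] at e3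
    have a1 := (R.facePerm x).adj
    have a2 := (R.facePerm (R.facePerm x)).adj
    rw [e1] at a1
    rw [e2, ← e3] at a2
    exact h3 _ _ _ x.adj a1 a2

end SimpleGraph.RotationSystem

/-! ### Rotation systems of Cayley graphs of abelian groups -/

namespace SimpleGraph

variable {V D : Type*} [AddCommGroup V] {G : SimpleGraph V} {σ : D → V}

/-- The darts of a Cayley graph are the pairs of a vertex and a generator. -/
noncomputable def cayleyDartEquiv (hσ : Function.Injective σ)
    (hG : ∀ u v, G.Adj u v ↔ ∃ s, v = u + σ s) : V × D ≃ G.Dart :=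
  Equiv.ofBijective (fun x => ⟨(x.1, x.1 + σ x.2), (hG _ _).2 ⟨x.2, rfl⟩⟩) <| by
    constructor
    · rintro ⟨u, s⟩ ⟨v, t⟩ h
      have h' := congrArg Dart.toProd h
      simp only [Prod.mk.injEq] at h'
      obtain ⟨rfl, h'⟩ := h'
      rw [hσ (add_left_cancel h')]
    · rintro ⟨⟨u, v⟩, h⟩
      obtain ⟨s, hs⟩ := (hG _ _).1 h
      change v = u + σ s at hs
      subst hs
      exact ⟨(u, s), rfl⟩

/-- The rotation system of a Cayley graph with the cyclic order `ρ v` of the generators at `v`. -/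
noncomputable def cayleyRotation (hσ : Function.Injective σ)
    (hG : ∀ u v, G.Adj u v ↔ ∃ s, v = u + σ s) (ρ : V → Equiv.Perm D)
    (hρ : ∀ v s t, ∃ k : ℕ, (ρ v ^ k) s = t) : RotationSystem G where
  next := (cayleyDartEquiv hσ hG).permCongr (Equiv.prodShear (Equiv.refl V) ρ)
  fst_next d := by
    obtain ⟨x, rfl⟩ := (cayleyDartEquiv hσ hG).surjective d
    rw [Equiv.permCongr_apply, Equiv.symm_apply_apply]
    rfl
  sameCycle d e h := by
    obtain ⟨⟨u, s⟩, rfl⟩ := (cayleyDartEquiv hσ hG).surjective d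
    obtain ⟨⟨v, t⟩, rfl⟩ := (cayleyDartEquiv hσ hG).surjective e
    obtain rfl : u = v := h
    obtain ⟨k, rfl⟩ := hρ u s t
    refine ⟨k, ?_⟩
    rw [zpow_natCast]
    induction k with
    | zero => rfl
    | succ k ih =>
      rw [pow_succ', Equiv.Perm.mul_apply, ih, Equiv.permCongr_apply, Equiv.symm_apply_apply,
        pow_succ', Equiv.Perm.mul_apply]
      rfl

/-- By `h`, two steps of face tracing turn direction `s` into its opposite, so each boundary walk
closes up as a parallelogram `s, t, -s, -t`. -/
theorem cayleyRotation_facePerm_pow_four (hσ : Function.Injective σ)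
    (hG : ∀ u v, G.Adj u v ↔ ∃ s, v = u + σ s) (ρ : V → Equiv.Perm D)
    (hρ : ∀ v s t, ∃ k : ℕ, (ρ v ^ k) s = t) (ν : D → D) (hν : ∀ s, σ (ν s) = -σ s)
    (h : ∀ v s, ρ (v + σ (ρ v s)) (ν (ρ v s)) = s) :
    (cayleyRotation hσ hG ρ hρ).facePerm ^ 4 = 1 := by
  have hνν : ∀ s, ν (ν s) = s := fun s => hσ (by rw [hν, hν, neg_neg])
  have hf : ∀ v s, (cayleyRotation hσ hG ρ hρ).facePerm (cayleyDartEquiv hσ hG (v, s)) =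
      cayleyDartEquiv hσ hG (v + σ s, ρ (v + σ s) (ν s)) := by
    intro v s
    have : (cayleyDartEquiv hσ hG (v, s)).symm = cayleyDartEquiv hσ hG (v + σ s, ν s) := by
      refine Dart.ext _ _ (Prod.ext rfl ?_)
      change v = v + σ s + σ (ν s)
      rw [hν, add_neg_cancel_right]
    rw [RotationSystem.facePerm_apply, this]
    change (cayleyDartEquiv hσ hG).permCongr (Equiv.prodShear (Equiv.refl V) ρ) _ = _
    rw [Equiv.permCongr_apply, Equiv.symm_apply_apply]
    rfl
  have hf2 : ∀ v s, ((cayleyRotation hσ hG ρ hρ).facePerm ^ 2) (cayleyDartEquiv hσ hG (v, s)) =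
      cayleyDartEquiv hσ hG (v + σ s + σ (ρ (v + σ s) (ν s)), ν s) := by
    intro v s
    rw [pow_two, Equiv.Perm.mul_apply, hf, hf, h]
  ext1 d
  obtain ⟨⟨v, s⟩, rfl⟩ := (cayleyDartEquiv hσ hG).surjective d
  have h1 := h (v + σ s) (ν s)
  have h2 := h (v + σ s + σ (ρ (v + σ s) (ν s))) (ν (ρ (v + σ s) (ν s)))
  rw [h1, hνν] at h2
  rw [show 4 = 2 + 2 from rfl, pow_add, Equiv.Perm.mul_apply, hf2, hf2, hνν, h2, hν, hν,
    Equiv.Perm.one_apply]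
  congr 2
  abel

end SimpleGraph

/-! ### The local rotations -/

namespace QuadRotation

/-- The four generators of a toroidal square lattice, in their cyclic order, and the two generators
`inr true`, `inr false` across the layers. -/
abbrev Dir := Fin 4 ⊕ Bool

/-- The direction opposite to a given one. -/
def opp : Dir → Dir
  | .inl i => .inl (i + 2)
  | .inr b => .inr (!b)

/-- The cyclic order `0, 1, 2, 3` with `inr true` inserted after `x` and `inr false` after `y`. -/
def succFun (x y : Fin 4) : Dir → Dir
  | .inl i => if i = x then .inr true else if i = y then .inr false else .inl (i + 1)
  | .inr true => .inl (x + 1)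
  | .inr false => .inl (y + 1)

/-- The reverse of the cyclic order `succFun x y`. -/
def predFun (x y : Fin 4) : Dir → Dir
  | .inl i => if i = x + 1 then .inr true else if i = y + 1 then .inr false else .inl (i - 1)
  | .inr true => .inl x
  | .inr false => .inl y

/-- The cyclic order `succFun x y` as a permutation. -/
def rot (x y : Fin 4) (h : x ≠ y) : Equiv.Perm Dir where
  toFun := succFun x y
  invFun := predFun x y
  left_inv := by revert x y; decide
  right_inv := by revert x y; decide

/-- The cyclic order `succFun x y` or its reverse. -/
def orot (p : Bool) (x y : Fin 4) (h : x ≠ y) : Equiv.Perm Dir :=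
  if p then (rot x y h)⁻¹ else rot x y h

/-- The underlying function of `orot`. -/
def orotFun (p : Bool) (x y : Fin 4) : Dir → Dir :=
  if p then predFun x y else succFun x y

theorem orot_apply (p : Bool) (x y : Fin 4) (h : x ≠ y) (s : Dir) :
    orot p x y h s = orotFun p x y s := by
  cases p <;> rfl

theorem succFun_iterate : ∀ (x y : Fin 4), x ≠ y → ∀ s t : Dir,
    ∃ k : Fin 6, (succFun x y)^[k] s = t := by
  decide +kernel

theorem rot_sameCycle (x y : Fin 4) (h : x ≠ y) (s t : Dir) : (rot x y h).SameCycle s t := by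
  obtain ⟨k, hk⟩ := succFun_iterate x y h s t
  refine ⟨(k : ℕ), ?_⟩
  rw [zpow_natCast, ← Equiv.Perm.iterate_eq_pow]
  exact hk

theorem exists_orot_pow_eq (p : Bool) (x y : Fin 4) (h : x ≠ y) (s t : Dir) :
    ∃ k : ℕ, (orot p x y h ^ k) s = t := by
  have hc : (orot p x y h).SameCycle s t := by
    cases p
    · exact rot_sameCycle x y h s t
    · exact (rot_sameCycle x y h s t).inv
  exact hc.exists_nat_pow_eq

/-- How the corner of a selected lattice square may change along a lattice direction. -/
def Compat (i x x' : Fin 4) : Prop :=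
  (i = 0 → x' = ![1, 0, 3, 2] x) ∧ (i = 2 → x' = ![1, 0, 3, 2] x) ∧
  (i = 1 → ((x = 0 ↔ x' = 3) ∧ (x = 1 ↔ x' = 2))) ∧
  (i = 3 → ((x' = 0 ↔ x = 3) ∧ (x' = 1 ↔ x = 2)))

instance (i x x' : Fin 4) : Decidable (Compat i x x') := by unfold Compat; infer_instance

/-- The ends of a lattice edge agree on whether the square beside it is intact or carries an upward
or downward tube. -/
theorem orotFun_lattice : ∀ (p : Bool) (x y x' y' : Fin 4) (s : Dir) (i : Fin 4),
    x ≠ y → x' ≠ y' → orotFun p x y s = .inl i → Compat i x x' → Compat i y y' →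
    orotFun p x' y' (.inl (i + 2)) = s := by
  decide +kernel

/-- The tube leaving at corner `x` arrives at corner `x` of the next layer, whose orientation is
reversed. -/
theorem orotFun_up : ∀ (p : Bool) (x y x' : Fin 4) (s : Dir), x ≠ y → x' ≠ x →
    orotFun p x y s = .inr true → orotFun (!p) x' x (.inr false) = s := by
  decide +kernel

theorem orotFun_down : ∀ (p : Bool) (x y y' : Fin 4) (s : Dir), x ≠ y → y ≠ y' →
    orotFun p x y s = .inr false → orotFun (!p) y y' (.inr true) = s := by
  decide +kernel

variable {V : Type*} [AddCommGroup V]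

/-- The generators `±a`, `±b`, `±c`, labelled by directions. -/
def gen (a b c : V) : Dir → V :=
  Sum.elim ![a, b, -a, -b] fun t => if t then c else -c

theorem gen_opp (a b c : V) (s : Dir) : gen a b c (opp s) = -gen a b c s := by
  rcases s with i | t
  · fin_cases i <;> simp [gen, opp]
  · cases t <;> simp [gen, opp]

/-- The position of `v` in its selected lattice square, where `χ` and `ψ` select the squares
`u, u + a, u + a + b, u + b` with `χ u = ψ u = false`. -/
def corner (χ ψ : V → Bool) (b v : V) : Fin 4 :=
  if χ v then if ψ (v - b) then 2 else 3 else if ψ v then 1 else 0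

section

variable {χ ψ : V → Bool} {a b : V}

theorem compat_corner_add_left (hχa : ∀ v, χ (v + a) = χ v) (hψa : ∀ v, ψ (v + a) = !ψ v) (v : V) :
    corner χ ψ b (v + a) = ![1, 0, 3, 2] (corner χ ψ b v) := by
  have h := hψa (v - b)
  rw [sub_add_eq_add_sub] at h
  unfold corner
  rw [hχa, hψa, h]
  cases χ v <;> cases ψ v <;> cases ψ (v - b) <;> rfl

/-- Only the step from the bottom to the top of a selected square is determined: `ψ` need not be
invariant under `b`, so consecutive rows of selected squares may be offset. -/
theorem compat_corner_add_right (hχb : ∀ v, χ (v + b) = !χ v) (v : V) :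
    (corner χ ψ b v = 0 ↔ corner χ ψ b (v + b) = 3) ∧
      (corner χ ψ b v = 1 ↔ corner χ ψ b (v + b) = 2) := by
  unfold corner
  rw [hχb, add_sub_cancel_right]
  cases χ v <;> cases ψ v <;> cases ψ (v - b) <;> cases ψ (v + b) <;> decide

theorem compat_corner (hχa : ∀ v, χ (v + a) = χ v) (hψa : ∀ v, ψ (v + a) = !ψ v)
    (hχb : ∀ v, χ (v + b) = !χ v) (c v : V) (i : Fin 4) :
    Compat i (corner χ ψ b v) (corner χ ψ b (v + gen a b c (.inl i))) := by
  refine ⟨?_, ?_, ?_, ?_⟩ <;> rintro rfl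
  · exact compat_corner_add_left hχa hψa v
  · have h := compat_corner_add_left (b := b) hχa hψa (v + -a)
    rw [neg_add_cancel_right] at h
    change corner χ ψ b (v + -a) = _
    rw [h]
    generalize corner χ ψ b (v + -a) = x
    fin_cases x <;> rfl
  · exact compat_corner_add_right hχb v
  · have h := compat_corner_add_right (ψ := ψ) hχb (v + -b)
    rw [neg_add_cancel_right] at h
    exact h

/-- If `χ` differs at `v` and `v + c`, one is a bottom corner and the other a top corner. Otherwise
`hc`, applied at `v` or at `v - b`, separates left from right. -/
theorem corner_add_ne {c : V} (hχb : ∀ v, χ (v + b) = !χ v)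
    (hc : ∀ v, χ v = false → χ (v + c) = false → ψ (v + c) ≠ ψ v) (v : V) :
    corner χ ψ b (v + c) ≠ corner χ ψ b v := by
  have hb : ∀ w, χ (w - b) = !χ w := fun w => by
    have := hχb (w - b)
    rw [sub_add_cancel] at this
    rw [this, Bool.not_not]
  have h1 := hc v
  have h2 := hc (v - b)
  rw [sub_add_eq_add_sub, hb, hb] at h2
  unfold corner
  revert h1 h2
  generalize χ v = x1, χ (v + c) = x2, ψ v = x3, ψ (v + c) = x4, ψ (v - b) = x5,
    ψ (v + c - b) = x6
  revert x1 x2 x3 x4 x5 x6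
  decide

end

theorem exists_facePerm_pow_four_eq_one {G : SimpleGraph V} {a b c : V}
    (hσ : Function.Injective (gen a b c)) (hG : ∀ u v, G.Adj u v ↔ ∃ s, v = u + gen a b c s)
    (χ ψ p : V → Bool) (hχa : ∀ v, χ (v + a) = χ v) (hψa : ∀ v, ψ (v + a) = !ψ v)
    (hχb : ∀ v, χ (v + b) = !χ v)
    (hc : ∀ v, χ v = false → χ (v + c) = false → ψ (v + c) ≠ ψ v)
    (hpa : ∀ v, p (v + a) = p v) (hpb : ∀ v, p (v + b) = p v) (hpc : ∀ v, p (v + c) = !p v) :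
    ∃ R : RotationSystem G, R.facePerm ^ 4 = 1 := by
  have hne : ∀ v, corner χ ψ b v ≠ corner χ ψ b (v - c) := fun v => by
    have := corner_add_ne hχb hc (v - c)
    rwa [sub_add_cancel] at this
  have hpl : ∀ v i, p (v + gen a b c (.inl i)) = p v := by
    intro v i
    have h1 := hpa (v + -a)
    have h2 := hpb (v + -b)
    rw [neg_add_cancel_right] at h1 h2
    fin_cases i
    exacts [hpa v, hpb v, h1.symm, h2.symm]
  -- The edge to `v + c` lies in the selected square of `v`, the edge to `v - c` in the translate of
  -- the selected square of `v - c`.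
  refine ⟨cayleyRotation hσ hG (fun v => orot (p v) _ _ (hne v))
    (fun v => exists_orot_pow_eq _ _ _ _), ?_⟩
  refine cayleyRotation_facePerm_pow_four hσ hG _ _ opp (gen_opp a b c) fun v s => ?_
  simp only [orot_apply]
  rcases ht : orotFun (p v) (corner χ ψ b v) (corner χ ψ b (v - c)) s with i | t
  · rw [hpl]
    refine orotFun_lattice _ _ _ _ _ s i (hne v) (hne _) ht (compat_corner hχa hψa hχb c v i) ?_
    rw [add_sub_right_comm]
    exact compat_corner hχa hψa hχb c (v - c) i
  · cases t
    · change orotFun (p (v + -c)) (corner χ ψ b (v + -c))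
        (corner χ ψ b (v + -c - c)) (.inr true) = s
      have h1 := hpc (v + -c)
      rw [neg_add_cancel_right] at h1
      simp only [← sub_eq_add_neg] at h1 ⊢
      rw [show p (v - c) = !p v by rw [h1, Bool.not_not]]
      exact orotFun_down _ _ _ _ s (hne v) (hne _) ht
    · change orotFun (p (v + c)) (corner χ ψ b (v + c)) (corner χ ψ b (v + c - c)) (.inr false) = s
      rw [hpc, add_sub_cancel_right]
      refine orotFun_up _ _ _ _ s (hne v) ?_ ht
      exact corner_add_ne hχb hc v

end QuadRotation

/-! ### Binary digits of integers -/

/-- The binary digit of `k` at place `i`. -/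
def binDigit (i : ℕ) (k : ℤ) : Bool := decide (k / 2 ^ i % 2 = 1)

theorem binDigit_add_pow_mul_odd (i : ℕ) (k : ℤ) {m : ℤ} (hm : Odd m) :
    binDigit i (k + 2 ^ i * m) = !binDigit i k := by
  unfold binDigit
  rw [Int.add_mul_ediv_left _ _ (by positivity), ← decide_not, decide_eq_decide]
  obtain ⟨t, rfl⟩ := hm
  omega

theorem binDigit_add_of_dvd {i j : ℕ} (hij : i < j) (k : ℤ) {m : ℤ} (hm : 2 ^ j ∣ m) :
    binDigit i (k + m) = binDigit i k := by
  obtain ⟨m, rfl⟩ := hm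
  obtain ⟨d, rfl⟩ := Nat.exists_eq_add_of_lt hij
  unfold binDigit
  rw [show (2 : ℤ) ^ (i + d + 1) * m = 2 ^ i * (2 * (2 ^ d * m)) by ring,
    Int.add_mul_ediv_left _ _ (by positivity), decide_eq_decide]
  omega

theorem binDigit_congr {i j : ℕ} (hij : i < j) {k k' : ℤ} (h : 2 ^ j ∣ k - k') :
    binDigit i k = binDigit i k' := by
  have := binDigit_add_of_dvd hij k' h
  rwa [add_sub_cancel] at this

/-- If adding one does not change a digit, it does not change the higher digits. -/
theorem binDigit_add_one_of_le {i j : ℕ} (hij : i ≤ j) {k : ℤ}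
    (h : binDigit i (k + 1) = binDigit i k) : binDigit j (k + 1) = binDigit j k := by
  obtain ⟨d, rfl⟩ := Nat.exists_eq_add_of_le hij
  have h2 : (0 : ℤ) < 2 ^ i := by positivity
  -- The quotient grows by 0 or 1, and its parity is unchanged.
  have h3 : (k + 1) / 2 ^ i = k / 2 ^ i := by
    unfold binDigit at h
    rw [decide_eq_decide] at h
    have h4 : k / 2 ^ i ≤ (k + 1) / 2 ^ i := Int.ediv_le_ediv h2 (by omega)
    have h5 : (k + 1) / 2 ^ i ≤ (k + 2 ^ i * 1) / 2 ^ i := Int.ediv_le_ediv h2 (by omega)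
    rw [Int.add_mul_ediv_left _ _ h2.ne'] at h5
    omega
  unfold binDigit
  rw [pow_add, ← Int.ediv_ediv_of_nonneg h2.le, ← Int.ediv_ediv_of_nonneg h2.le, h3]

theorem le_of_two_pow_dvd {r i : ℕ} {m : ℤ} (hm : Odd m) (h : (2 : ℤ) ^ r ∣ 2 ^ i * m) :
    r ≤ i := by
  have hc : IsCoprime ((2 : ℤ) ^ r) m :=
    IsCoprime.pow_left (Int.isCoprime_two_left.2 hm)
  exact (pow_dvd_pow_iff (two_ne_zero) (by decide)).1 (hc.dvd_of_dvd_mul_right h)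

/-! ### The generators of the circulant graph -/

theorem not_dvd_of_natAbs_le_three {n A B C : ℤ} {r r₁ l₁ r₂ l₂ : ℕ} (hn : (2 : ℤ) ^ r ∣ n)
    (hA : A = 2 ^ r₁ * l₁) (hB : B = 2 ^ r₂ * l₂) (hl₁ : Odd l₁) (hl₂ : Odd l₂) (hC : Odd C)
    (hr₂ : 0 < r₂) (hr₂₁ : r₂ < r₁) (hr₁ : r₁ < r) (hA2 : ¬ n ∣ 2 * A)
    (h₁₂ : ¬ n ∣ A - 2 * B) (h₁₂' : ¬ n ∣ A + 2 * B)
    (h₂₃ : ¬ n ∣ B - 2 * C) (h₂₃' : ¬ n ∣ B + 2 * C)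
    (x y z : ℤ) (h0 : x ≠ 0 ∨ y ≠ 0 ∨ z ≠ 0) (h3 : x.natAbs + y.natAbs + z.natAbs ≤ 3) :
    ¬ n ∣ x * A + y * B + z * C := by
  intro h
  have hl₁' : Odd (l₁ : ℤ) := by exact_mod_cast hl₁
  have hl₂' : Odd (l₂ : ℤ) := by exact_mod_cast hl₂
  obtain ⟨s, rfl⟩ := Nat.exists_eq_add_of_lt hr₂
  obtain ⟨t, rfl⟩ := Nat.exists_eq_add_of_lt hr₂₁
  -- A combination divisible by `n` has 2-adic valuation at least `r`; the cases below either
  -- violate this or are excluded congruences.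
  have key : ∀ (i : ℕ) (m : ℤ), x * A + y * B + z * C = 2 ^ i * m → Odd m →
      r ≤ i := fun i m he hm => le_of_two_pow_dvd hm (he ▸ hn.trans h)
  rcases Int.even_or_odd z with hz | hz
  · rcases Int.even_or_odd y with hy | hy
    · rcases Int.even_or_odd x with hx | hx
      · obtain ⟨z, rfl⟩ := hz
        obtain ⟨y, rfl⟩ := hy
        obtain ⟨x, rfl⟩ := hx
        have hh : (x = 0 ∧ y = 0 ∧ (z = 1 ∨ z = -1)) ∨ (x = 0 ∧ (y = 1 ∨ y = -1) ∧ z = 0) ∨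
          ((x = 1 ∨ x = -1) ∧ y = 0 ∧ z = 0) := by omega
        rcases hh with ⟨rfl, rfl, hz⟩ | ⟨rfl, hy, rfl⟩ | ⟨hx, rfl, rfl⟩
        · have := key 1 (z * C) (by ring) (Odd.mul (by rcases hz with rfl | rfl <;> decide) hC)
          omega
        · have := key (0 + s + 1 + 1) (y * l₂) (by rw [hB]; ring)
            (Odd.mul (by rcases hy with rfl | rfl <;> decide) hl₂')
          omega
        · apply hA2
          rcases hx with rfl | rfl
          · convert h using 1; ring
          · obtain ⟨k, hk⟩ := h; exact ⟨-k, by linear_combination -hk⟩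
      · have hh : (y = 0 ∧ z = 0) ∨ (y = 0 ∧ ∃ w, z = 2 * w ∧ (w = 1 ∨ w = -1)) ∨
            ((x = 1 ∨ x = -1) ∧ (y = 2 ∨ y = -2) ∧ z = 0) := by
          obtain ⟨z, rfl⟩ := hz
          obtain ⟨y, rfl⟩ := hy
          obtain ⟨x, rfl⟩ := hx
          by_cases hz0 : z = 0
          · omega
          · exact Or.inr (Or.inl ⟨by omega, z, by omega, by omega⟩)
        rcases hh with ⟨rfl, rfl⟩ | ⟨rfl, w, rfl, hw⟩ | ⟨hx, hy, rfl⟩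
        · have := key (0 + s + 1 + t + 1) (x * l₁) (by rw [hA]; ring) (hx.mul hl₁')
          omega
        · have := key 1 (2 * (x * 2 ^ (s + t) * l₁) + w * C) (by rw [hA]; ring)
            ((even_two_mul _).add_odd
              (Odd.mul (by rcases hw with rfl | rfl <;> decide) hC))
          omega
        · rcases hx with rfl | rfl <;> rcases hy with rfl | rfl
          · apply h₁₂'; convert h using 1; ring
          · apply h₁₂; convert h using 1; ring
          · apply h₁₂; obtain ⟨k, hk⟩ := h; exact ⟨-k, by linear_combination -hk⟩
          · apply h₁₂'; obtain ⟨k, hk⟩ := h; exact ⟨-k, by linear_combination -hk⟩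
    · have hh : z = 0 ∨ (x = 0 ∧ (y = 1 ∨ y = -1) ∧ (z = 2 ∨ z = -2)) := by
        obtain ⟨z, rfl⟩ := hz
        obtain ⟨y, rfl⟩ := hy
        omega
      rcases hh with rfl | ⟨rfl, hy, hz⟩
      · have := key (0 + s + 1) (2 * (x * 2 ^ t * l₁) + y * l₂) (by rw [hA, hB]; ring)
          ((even_two_mul _).add_odd (hy.mul hl₂'))
        omega
      · rcases hy with rfl | rfl <;> rcases hz with rfl | rfl
        · apply h₂₃'; convert h using 1; ring
        · apply h₂₃; convert h using 1; ring
        · apply h₂₃; obtain ⟨k, hk⟩ := h; exact ⟨-k, by linear_combination -hk⟩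
        · apply h₂₃'; obtain ⟨k, hk⟩ := h; exact ⟨-k, by linear_combination -hk⟩
  · have := key 0 (2 * (x * 2 ^ (s + t + 1) * l₁ + y * 2 ^ s * l₂) + z * C)
      (by rw [hA, hB]; ring) ((even_two_mul _).add_odd (hz.mul hC))
    omega

namespace QuadRotation

theorem gen_intCast (n : ℕ) (A B C : ℤ) (s : Dir) :
    gen (A : ZMod n) B C s =
      ((gen 1 0 0 s * A + gen 0 1 0 s * B + gen 0 0 1 s * C : ℤ) : ZMod n) := by
  rcases s with i | t
  · fin_cases i <;> simp [gen]
  · cases t <;> simp [gen]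

theorem gen_sub_coeff : ∀ s t : Dir, s ≠ t →
    (gen (1 : ℤ) 0 0 s - gen 1 0 0 t ≠ 0 ∨ gen (0 : ℤ) 1 0 s - gen 0 1 0 t ≠ 0 ∨
      gen (0 : ℤ) 0 1 s - gen 0 0 1 t ≠ 0) ∧
    (gen (1 : ℤ) 0 0 s - gen 1 0 0 t).natAbs + (gen (0 : ℤ) 1 0 s - gen 0 1 0 t).natAbs +
      (gen (0 : ℤ) 0 1 s - gen 0 0 1 t).natAbs ≤ 3 := by
  decide +kernel

theorem gen_coeff : ∀ s : Dir,
    (gen (1 : ℤ) 0 0 s ≠ 0 ∨ gen (0 : ℤ) 1 0 s ≠ 0 ∨ gen (0 : ℤ) 0 1 s ≠ 0) ∧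
    (gen (1 : ℤ) 0 0 s).natAbs + (gen (0 : ℤ) 1 0 s).natAbs + (gen (0 : ℤ) 0 1 s).natAbs ≤ 3 := by
  decide +kernel

/-- Three unit steps have an odd coefficient sum, so they cannot cancel formally. -/
theorem gen_add_add_coeff : ∀ s t u : Dir,
    (gen (1 : ℤ) 0 0 s + gen 1 0 0 t + gen 1 0 0 u ≠ 0 ∨
      gen (0 : ℤ) 1 0 s + gen 0 1 0 t + gen 0 1 0 u ≠ 0 ∨
      gen (0 : ℤ) 0 1 s + gen 0 0 1 t + gen 0 0 1 u ≠ 0) ∧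
    (gen (1 : ℤ) 0 0 s + gen 1 0 0 t + gen 1 0 0 u).natAbs +
      (gen (0 : ℤ) 1 0 s + gen 0 1 0 t + gen 0 1 0 u).natAbs +
      (gen (0 : ℤ) 0 1 s + gen 0 0 1 t + gen 0 0 1 u).natAbs ≤ 3 := by
  decide +kernel

section

variable {n : ℕ} {A B C : ℤ}

theorem gen_injective (h : ∀ x y z : ℤ, (x ≠ 0 ∨ y ≠ 0 ∨ z ≠ 0) →
    x.natAbs + y.natAbs + z.natAbs ≤ 3 → ¬ (n : ℤ) ∣ x * A + y * B + z * C) :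
    Function.Injective (gen (A : ZMod n) B C) := by
  intro s t hst
  by_contra hne
  obtain ⟨h0, h3⟩ := gen_sub_coeff s t hne
  refine h _ _ _ h0 h3 ((ZMod.intCast_zmod_eq_zero_iff_dvd _ _).1 ?_)
  rw [gen_intCast, gen_intCast, ← sub_eq_zero, ← Int.cast_sub] at hst
  rw [← hst]
  congr 1
  ring

theorem gen_ne_zero (h : ∀ x y z : ℤ, (x ≠ 0 ∨ y ≠ 0 ∨ z ≠ 0) →
    x.natAbs + y.natAbs + z.natAbs ≤ 3 → ¬ (n : ℤ) ∣ x * A + y * B + z * C) (s : Dir) :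
    gen (A : ZMod n) B C s ≠ 0 := by
  rw [gen_intCast, Ne, ZMod.intCast_zmod_eq_zero_iff_dvd]
  exact h _ _ _ (gen_coeff s).1 (gen_coeff s).2

theorem gen_add_add_ne_zero (h : ∀ x y z : ℤ, (x ≠ 0 ∨ y ≠ 0 ∨ z ≠ 0) →
    x.natAbs + y.natAbs + z.natAbs ≤ 3 → ¬ (n : ℤ) ∣ x * A + y * B + z * C) (s t u : Dir) :
    gen (A : ZMod n) B C s + gen (A : ZMod n) B C t + gen (A : ZMod n) B C u ≠ 0 := by
  obtain ⟨h0, h3⟩ := gen_add_add_coeff s t u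
  rw [gen_intCast, gen_intCast, gen_intCast, ← Int.cast_add, ← Int.cast_add, Ne,
    ZMod.intCast_zmod_eq_zero_iff_dvd]
  convert h _ _ _ h0 h3 using 2
  ring

end

theorem circulantGraph_adj_iff_exists_gen {V : Type*} [AddCommGroup V] {a b c : V}
    (h : ∀ s, gen a b c s ≠ 0) (u v : V) :
    (circulantGraph {a, b, c}).Adj u v ↔ ∃ s, v = u + gen a b c s := by
  simp only [circulantGraph_adj, Set.mem_insert_iff, Set.mem_singleton_iff]
  constructor
  · rintro ⟨-, (h | h | h) | h | h | h⟩
    · exact ⟨.inl 2, by simp [gen, ← h]⟩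
    · exact ⟨.inl 3, by simp [gen, ← h]⟩
    · exact ⟨.inr false, by simp [gen, ← h]⟩
    · exact ⟨.inl 0, by simp [gen, ← h]⟩
    · exact ⟨.inl 1, by simp [gen, ← h]⟩
    · exact ⟨.inr true, by simp [gen, ← h]⟩
  · rintro ⟨s, rfl⟩
    refine ⟨fun he => h s (left_eq_add.1 he), ?_⟩
    rcases s with i | t
    · fin_cases i <;> simp [gen]
    · cases t <;> simp [gen]

/-- The digits of the residues modulo a multiple of `2 ^ r`, in units of `c`, yield the selection of
lattice squares. -/
theorem exists_facePerm_pow_four_eq_one_of_zmod {n r r₁ r₂ : ℕ} [NeZero n] {A B C l₁ l₂ : ℤ}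
    {G : SimpleGraph (ZMod n)} (hn : 2 ^ r ∣ n) (hA : A = 2 ^ r₁ * l₁) (hB : B = 2 ^ r₂ * l₂)
    (hl₁ : Odd l₁) (hl₂ : Odd l₂) (hC : Odd C) (hr₂ : 0 < r₂) (hr₂₁ : r₂ < r₁) (hr₁ : r₁ < r)
    (hσ : Function.Injective (gen (A : ZMod n) B C))
    (hG : ∀ u v, G.Adj u v ↔ ∃ s, v = u + gen (A : ZMod n) B C s) :
    ∃ R : RotationSystem G, R.facePerm ^ 4 = 1 := by
  -- With `e` inverse to `C` modulo `2 ^ r`, adding `c` to `v` adds 1 to `v * e` modulo `2 ^ r`.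
  obtain ⟨e, he⟩ : ∃ e : ℤ, (2 : ℤ) ^ r ∣ C * e - 1 := by
    obtain ⟨x, y, hxy⟩ : IsCoprime ((2 : ℤ) ^ r) C :=
      IsCoprime.pow_left (Int.isCoprime_two_left.2 hC)
    exact ⟨y, -x, by linear_combination hxy⟩
  have he2 : Odd e := by
    have : (2 : ℤ) ∣ C * e - 1 := (dvd_pow_self 2 (by omega)).trans he
    rcases Int.even_or_odd e with h | h
    · obtain ⟨k, rfl⟩ := h
      obtain ⟨m, hm⟩ := this
      have : (2 : ℤ) ∣ 1 := ⟨C * k - m, by linear_combination -hm⟩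
      omega
    · exact h
  have hadd : ∀ (v : ZMod n) (z : ℤ) (i : ℕ), i < r →
      binDigit i ((v + (z : ZMod n)).val * e) = binDigit i (v.val * e + z * e) := by
    intro v z i hi
    refine binDigit_congr hi ?_
    rw [← add_mul, ← sub_mul]
    refine Dvd.dvd.mul_right ((show (2 : ℤ) ^ r ∣ n by exact_mod_cast hn).trans ?_) _
    rw [← ZMod.intCast_zmod_eq_zero_iff_dvd]
    simp
  have hone : ∀ (v : ZMod n) (i : ℕ), i < r →
      binDigit i ((v + (C : ZMod n)).val * e) = binDigit i (v.val * e + 1) := by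
    intro v i hi
    rw [hadd v C i hi]
    refine binDigit_congr hi ?_
    convert he using 1
    ring
  have hAe : A * e = 2 ^ r₁ * (l₁ * e) := by rw [hA, mul_assoc]
  have hBe : B * e = 2 ^ r₂ * (l₂ * e) := by rw [hB, mul_assoc]
  have hA0 : ∀ v : ZMod n, binDigit 0 ((v + (A : ZMod n)).val * e) = binDigit 0 (v.val * e) := by
    intro v
    rw [hadd v A 0 (by omega), hAe, binDigit_add_of_dvd (j := r₁) (by omega) _ (Dvd.intro _ rfl)]
  have hC0 : ∀ k : ℤ, binDigit 0 (k + 1) = !binDigit 0 k := fun k => by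
    simpa using binDigit_add_pow_mul_odd 0 k odd_one
  -- Digit `r₂` flips under `b` and not under `a`; digit `r₁` flips under `a`. Digit 0 is the parity
  -- of the layer, and its presence in `ψ` makes `c` flip `ψ` when no carry reaches digit `r₁`.
  refine exists_facePerm_pow_four_eq_one hσ hG (fun v => binDigit r₂ (v.val * e))
    (fun v => xor (binDigit r₁ (v.val * e)) (binDigit 0 (v.val * e)))
    (fun v => binDigit 0 (v.val * e)) ?_ ?_ ?_ ?_ hA0 ?_ ?_ <;> intro v
  · rw [hadd v A r₂ (by omega), hAe, binDigit_add_of_dvd hr₂₁ _ (Dvd.intro _ rfl)]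
  · rw [hA0, hadd v A r₁ hr₁, hAe, binDigit_add_pow_mul_odd _ _ (hl₁.mul he2), Bool.not_xor]
  · rw [hadd v B r₂ (by omega), hBe, binDigit_add_pow_mul_odd _ _ (hl₂.mul he2)]
  · intro h1 h2
    rw [hone v r₂ (by omega)] at h2
    -- As digit `r₂` is unchanged, no carry passes it and digit `r₁` is unchanged too.
    have h3 := binDigit_add_one_of_le hr₂₁.le (h2.trans h1.symm)
    rw [hone v r₁ hr₁, hone v 0 (by omega), h3, hC0]
    simp
  · rw [hadd v B 0 (by omega), hBe, binDigit_add_of_dvd hr₂ _ (Dvd.intro _ rfl)]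
  · rw [hone v 0 (by omega), hC0]

end QuadRotation

/-! ### Edge count and the genus by Euler's relation -/

theorem SimpleGraph.two_mul_card_edgeSet {V : Type*} [Finite V] (G : SimpleGraph V) :
    2 * Nat.card G.edgeSet = Nat.card G.Dart := by
  classical
  have := Fintype.ofFinite V
  rw [Nat.card_eq_fintype_card, Nat.card_eq_fintype_card, dart_card_eq_twice_card_edges,
    edgeFinset_card]

open QuadRotation in
theorem proposition4p3 (n a₁ a₂ a₃ r l r₁ l₁ r₂ l₂ : ℕ) [NeZero n]
    (hn : n = 2 ^ r * l) (ha₁ : a₁ = 2 ^ r₁ * l₁) (ha₂ : a₂ = 2 ^ r₂ * l₂)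
    (hl : Odd l) (hl₁ : Odd l₁) (hl₂ : Odd l₂) (ha₃ : Odd a₃)
    (hr₂ : 0 < r₂) (hr₂₁ : r₂ < r₁) (hr₁ : r₁ < r)
    -- the jumps lie between 1 and n / 2, and the graph is 6-regular
    (h₁ : 2 * a₁ ≤ n) (h₂ : 2 * a₂ ≤ n) (h₃ : 2 * a₃ ≤ n) (hdeg : 2 * a₁ ≠ n)
    -- modulo n, no jump is plus or minus twice the next one
    (h₁₂ : (a₁ : ZMod n) ≠ 2 * (a₂ : ZMod n)) (h₁₂' : (a₁ : ZMod n) ≠ -(2 * (a₂ : ZMod n)))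
    (h₂₃ : (a₂ : ZMod n) ≠ 2 * (a₃ : ZMod n)) (h₂₃' : (a₂ : ZMod n) ≠ -(2 * (a₃ : ZMod n)))
    (hconn : (circulant3 n a₁ a₂ a₃).Connected) :
    ∃ g : ℕ, (circulant3 n a₁ a₂ a₃).IsGenus g ∧ (g : ℚ) = ((n : ℚ) + 4) / 4 := by
  have hrel := not_dvd_of_natAbs_le_three (n := n) (A := a₁) (B := a₂) (C := a₃) (r := r)
    (by rw [hn]; push_cast; exact Dvd.intro _ rfl) (by rw [ha₁]; push_cast; rfl)
    (by rw [ha₂]; push_cast; rfl) hl₁ hl₂ (by exact_mod_cast ha₃) hr₂ hr₂₁ hr₁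
    (fun h => by
      have h0 : 0 < 2 * a₁ := by
        have := hl₁.pos
        rw [ha₁]
        positivity
      have := Nat.le_of_dvd h0 (by exact_mod_cast h)
      omega)
    (fun h => h₁₂ (by
      rw [← ZMod.intCast_zmod_eq_zero_iff_dvd] at h
      push_cast at h
      exact sub_eq_zero.1 h))
    (fun h => h₁₂' (by
      rw [← ZMod.intCast_zmod_eq_zero_iff_dvd] at h
      push_cast at h
      exact eq_neg_of_add_eq_zero_left h))
    (fun h => h₂₃ (by
      rw [← ZMod.intCast_zmod_eq_zero_iff_dvd] at h
      push_cast at h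
      exact sub_eq_zero.1 h))
    (fun h => h₂₃' (by
      rw [← ZMod.intCast_zmod_eq_zero_iff_dvd] at h
      push_cast at h
      exact eq_neg_of_add_eq_zero_left h))
  have hinj := gen_injective hrel
  have hadj : ∀ u v, (circulant3 n a₁ a₂ a₃).Adj u v ↔
      ∃ s, v = u + gen (((a₁ : ℤ) : ZMod n)) ((a₂ : ℤ) : ZMod n) ((a₃ : ℤ) : ZMod n) s := by
    intro u v
    rw [← circulantGraph_adj_iff_exists_gen (gen_ne_zero hrel)]
    simp [circulant3]
  have hdart : Nat.card (circulant3 n a₁ a₂ a₃).Dart = 6 * n := by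
    rw [← Nat.card_congr (cayleyDartEquiv hinj hadj), Nat.card_prod, Nat.card_zmod]
    simp [mul_comm]
  have hedge := (circulant3 n a₁ a₂ a₃).two_mul_card_edgeSet
  have hcc : Nat.card (circulant3 n a₁ a₂ a₃).ConnectedComponent = 1 := by
    have := hconn.preconnected.subsingleton_connectedComponent
    have : Nonempty (circulant3 n a₁ a₂ a₃).ConnectedComponent :=
      ⟨(circulant3 n a₁ a₂ a₃).connectedComponentMk 0⟩
    exact Nat.card_unique
  have hiso : Nat.card {v // ∀ w, ¬ (circulant3 n a₁ a₂ a₃).Adj v w} = 0 := by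
    have : IsEmpty {v // ∀ w, ¬ (circulant3 n a₁ a₂ a₃).Adj v w} :=
      ⟨fun v => v.2 _ ((hadj _ _).2 ⟨.inl 0, rfl⟩)⟩
    exact Nat.card_of_isEmpty
  have hV : Nat.card (ZMod n) = n := Nat.card_zmod n
  have h4 : 4 ∣ n := by
    rw [hn, show r = 2 + (r - 2) by omega, pow_add, mul_assoc]
    exact Dvd.intro _ rfl
  have hlower : ∀ R : SimpleGraph.RotationSystem (circulant3 n a₁ a₂ a₃),
      4 * R.numFaces ≤ 6 * n := by
    intro R
    rw [SimpleGraph.RotationSystem.numFaces, hiso, add_zero, ← hdart]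
    refine R.four_mul_card_face_le (fun u v w h1 h2 h3 => ?_) fun u v _ => ?_
    · obtain ⟨s, hs⟩ := (hadj _ _).1 h1
      obtain ⟨t, ht⟩ := (hadj _ _).1 h2
      obtain ⟨x, hx⟩ := (hadj _ _).1 h3
      refine gen_add_add_ne_zero hrel s t x (add_left_cancel (a := u) ?_)
      rw [add_zero, ← add_assoc, ← add_assoc, ← hs, ← ht, ← hx]
    · by_cases hv : u + gen (((a₁ : ℤ) : ZMod n)) ((a₂ : ℤ) : ZMod n) ((a₃ : ℤ) : ZMod n)
        (.inl 0) = v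
      · refine ⟨_, (hadj _ _).2 ⟨.inl 1, rfl⟩, fun he => ?_⟩
        have := hinj (add_left_cancel (hv.trans he.symm))
        simp at this
      · exact ⟨_, (hadj _ _).2 ⟨.inl 0, rfl⟩, hv⟩
  obtain ⟨R, hR⟩ := exists_facePerm_pow_four_eq_one_of_zmod (r := r) (r₁ := r₁) (r₂ := r₂)
    (l₁ := l₁) (l₂ := l₂) (by rw [hn]; exact Dvd.intro _ rfl) (by rw [ha₁]; push_cast; rfl)
    (by rw [ha₂]; push_cast; rfl) (by exact_mod_cast hl₁) (by exact_mod_cast hl₂)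
    (by exact_mod_cast ha₃) hr₂ hr₂₁ hr₁ hinj hadj
  have hupper : 6 * n ≤ 4 * R.numFaces := by
    have : Finite (circulant3 n a₁ a₂ a₃).Dart := .of_equiv _ (cayleyDartEquiv hinj hadj)
    rw [SimpleGraph.RotationSystem.numFaces, hiso, add_zero, ← hdart]
    exact R.facePerm.card_le_mul_card_quotient_sameCycle (by norm_num) hR
  obtain ⟨m, rfl⟩ := h4
  -- With `n = 4 * m` there are `12 * m` edges and at most `6 * m` faces, attained by `R`.
  refine ⟨m + 1, ⟨⟨R, ?_⟩, ?_⟩, ?_⟩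
  · have := hlower R
    rw [SimpleGraph.RotationSystem.HasGenus, hV, hcc]
    omega
  · rintro g ⟨S, hS⟩
    have := hlower S
    rw [SimpleGraph.RotationSystem.HasGenus, hV, hcc] at hS
    omega
  · push_cast
    ring
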